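/- Let $\Sigma$ be a finite alphabet. A timed word over $\Sigma$ is a non-empty finite sequence $w=(a_1,t_1)\dots(a_n,t_n)$ in $\Sigma\times\mathbb{R}_{\ge 0}$ with $t_1\le\dots\le t_n$. A parametric timed automaton $\mathcal{A}$ over $\Sigma$ consists of finite sets of locations $\mathcal{L}$, initial locations $\mathcal{L}_0\subseteq\mathcal{L}$, final locations $\mathcal{L}_F\subseteq\mathcal{L}$, clocks $\mathcal{X}$, parameters $\mathcal{P}$, and edges $(l,a,\phi,\lambda,l')$, where $l,l'\in\mathcal{L}$, $a\in\Sigma$, $\lambda\subseteq\mathcal{X}$, and $\phi$ is a finite (possibly empty) conjunction of constraints $x\sim c$ with $x\in\mathcal{X}$, $c\in\mathbb{N}\cup\mathcal{P}$, ${\sim}\in\{<,\le,=,\ge,>\}$. A parameter valuation is a map $pv:\mathcal{P}\to\mathbb{Q}_{\ge 0}$, a clock valuation is a map $\nu:\mathcal{X}\to\mathbb{R}_{\ge 0}$, and $(\nu,pv)\models\phi$ means that $\phi$ is true when each clock $x$ is replaced by $\nu(x)$ and each parameter $p$ by $pv(p)$. From a global state $(l,\nu)$, reading $a$ after a delay $\delta\in\mathbb{R}_{\ge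 0}$, the automaton may move to $(l',\nu')$ if it has an edge $(l,a,\phi,\lambda,l')$ such that $(\nu+\delta,pv)\models\phi$, where $\nu'$ is $\nu+\delta$ with the clocks in $\lambda$ reset to $0$. The timed language $L_{pv}(\mathcal{A})$ is the set of timed words $(a_1,\delta_1)(a_2,\delta_1+\delta_2)\dots(a_k,\delta_1+\dots+\delta_k)$ read along finite runs that start in a location of $\mathcal{L}_0$ with all clocks equal to $0$ and end in a location of $\mathcal{L}_F$. The automaton is deterministic if $\mathcal{L}_0$ is a singleton and, for any two different edges $(l,a,\phi_1,\lambda_1,l_1)$ and $(l,a,\phi_2,\lambda_2,l_2)$ with the same source and the same letter, no clock valuation and parameter valuation satisfy $\phi_1\wedge\phi_2$. MTL formulae over $\Sigma$ are given by $\varphi::=a\mid\neg\varphi\mid\varphi_1\wedge\varphi_2\mid\varphi_1\mathsf{U}_I\varphi_2$, where $a\in\Sigma$ and $I\subseteq\mathbb{R}_{\ge 0}$ is an open, closed or half-open interval with endpoints in $\mathbb{N}\cup\{\infty\}$. For a timed word $w=(a_1,t_1)\dots(a_n,t_n)$ and $1\le i\le n$: $(w,i)\models a$ iff $a_i=a$;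 negation and conjunction are as usual; and $(w,i)\models\varphi_1\mathsf{U}_I\varphi_2$ iff there is $j$ with $i<j\le n$ such that $(w,j)\models\varphi_2$, $t_j-t_i\in I$, and $(w,k)\models\varphi_1$ for all $k$ with $i<k<j$. We write $w\models\varphi$ for $(w,1)\models\varphi$. MTL-model checking problem for parametric timed automata. Input: a parametric timed automaton $\mathcal{A}$ and an MTL formula $\varphi$ over the same finite alphabet. Question: is there a parameter valuation $pv$ such that $w\models\varphi$ for every $w\in L_{pv}(\mathcal{A})$? Theorem. The MTL-model checking problem for parametric timed automata is undecidable. It remains undecidable when restricted to deterministic automata with exactly one clock and exactly one parameter: no algorithm halts with the correct answer on all such inputs. -/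

import Mathlib

open scoped NNReal

/-! ### Clock constraints -/

/-- The comparison symbols `<, ≤, =, ≥, >`. -/
inductive Cmp where
  | lt | le | eq | ge | gt

namespace Cmp

def holds : Cmp → ℝ≥0 → ℝ≥0 → Prop
  | lt, a, b => a < b
  | le, a, b => a ≤ b
  | eq, a, b => a = b
  | ge, a, b => a ≥ b
  | gt, a, b => a > b

def code : Cmp → ℕ
  | lt => 0
  | le => 1
  | eq => 2
  | ge => 3
  | gt => 4

end Cmp

/-- A bound in a clock constraint: a natural number (`Sum.inl`) or a parameter (`Sum.inr`). -/
abbrev Bound (P : Type) := ℕ ⊕ P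

/-- Clock valuations over the clocks `X`. -/
abbrev ClockVal (X : Type) := X → ℝ≥0

/-- Parameter valuations: every parameter is a non-negative rational number. -/
abbrev ParamVal (P : Type) := P → ℚ≥0

def Bound.value {P : Type} (pv : ParamVal P) : Bound P → ℝ≥0
  | Sum.inl n => (n : ℝ≥0)
  | Sum.inr p => ((pv p : ℚ≥0) : ℝ≥0)

/-- An atomic constraint `x ∼ c`. -/
structure ClockAtom (X P : Type) where
  clock : X
  cmp : Cmp
  bound : Bound P

/-- A clock constraint is a (possibly empty) conjunction of atomic constraints. -/
abbrev ClockConstraint (X P : Type) := List (ClockAtom X P)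

/-- `(ν, pv) ⊨ φ`. -/
def ClockConstraint.Sat {X P : Type} (ν : ClockVal X) (pv : ParamVal P)
    (φ : ClockConstraint X P) : Prop :=
  ∀ g ∈ φ, g.cmp.holds (ν g.clock) (Bound.value pv g.bound)

/-! ### Parametric timed automata -/

structure PTAEdge (S L X P : Type) where
  src : L
  label : S
  guard : ClockConstraint X P
  reset : Finset X
  tgt : L

/-- A parametric timed automaton with alphabet `S`, locations `L`, clocks `X` and parameters `P`.
The finite set of edges is given by a list of its elements. -/
structure PTA (S L X P : Type) where
  init : Finset L
  edges : List (PTAEdge S L X P)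
  final : Finset L

/-- Non-empty finite timed words over `S`: the sequence of timestamps is non-decreasing. -/
structure TimedWord (S : Type) where
  len : ℕ
  len_pos : 0 < len
  letter : Fin len → S
  time : Fin len → ℝ≥0
  time_mono : Monotone time

namespace PTA

/-- The labelled transition relation between global states induced by `pv`:
let `δ` time units elapse, then take an edge labelled with `a`. -/
def Step {S L X P : Type} [DecidableEq X] (A : PTA S L X P) (pv : ParamVal P)
    (s : L × ClockVal X) (a : S) (δ : ℝ≥0) (s' : L × ClockVal X) : Prop :=
  ∃ e ∈ A.edges, e.src = s.1 ∧ e.label = a ∧ e.tgt = s'.1 ∧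
    ClockConstraint.Sat (fun x => s.2 x + δ) pv e.guard ∧
    s'.2 = fun x => if x ∈ e.reset then 0 else s.2 x + δ

/-- A run with `k` transitions under the parameter valuation `pv`. -/
structure Run {S L X P : Type} [DecidableEq X] (A : PTA S L X P) (pv : ParamVal P) (k : ℕ) where
  state : Fin (k + 1) → L × ClockVal X
  letter : Fin k → S
  delay : Fin k → ℝ≥0
  step : ∀ i : Fin k, A.Step pv (state i.castSucc) (letter i) (delay i) (state i.succ)

def Run.Successful {S L X P : Type} [DecidableEq X] {A : PTA S L X P} {pv : ParamVal P} {k : ℕ}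
    (r : A.Run pv k) : Prop :=
  (r.state 0).1 ∈ A.init ∧ (∀ x, (r.state 0).2 x = 0) ∧ (r.state (Fin.last k)).1 ∈ A.final

/-- The set of timed words associated with a successful run of `A` under `pv`:
the timestamp of a letter is the sum of the delays up to it. -/
def language {S L X P : Type} [DecidableEq X] (A : PTA S L X P) (pv : ParamVal P) :
    Set (TimedWord S) :=
  {w | ∃ r : A.Run pv w.len, r.Successful ∧ r.letter = w.letter ∧
    ∀ i, w.time i = ∑ j ∈ Finset.Iic i, r.delay j}

def Deterministic {S L X P : Type} (A : PTA S L X P) : Prop :=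
  (∃ l, A.init = {l}) ∧
    ∀ e₁ ∈ A.edges, ∀ e₂ ∈ A.edges, e₁ ≠ e₂ → e₁.src = e₂.src → e₁.label = e₂.label →
      ∀ (pv : ParamVal P) (ν : ClockVal X),
        ¬ (ClockConstraint.Sat ν pv e₁.guard ∧ ClockConstraint.Sat ν pv e₂.guard)

end PTA

/-! ### Metric temporal logic -/

/-- Intervals with endpoints in `ℕ ∪ {∞}`. -/
inductive TimeInterval where
  | Icc (a b : ℕ)
  | Ico (a b : ℕ)
  | Ioc (a b : ℕ)
  | Ioo (a b : ℕ)
  | Ici (a : ℕ)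
  | Ioi (a : ℕ)

namespace TimeInterval

def toSet : TimeInterval → Set ℝ
  | Icc a b => Set.Icc (a : ℝ) b
  | Ico a b => Set.Ico (a : ℝ) b
  | Ioc a b => Set.Ioc (a : ℝ) b
  | Ioo a b => Set.Ioo (a : ℝ) b
  | Ici a => Set.Ici (a : ℝ)
  | Ioi a => Set.Ioi (a : ℝ)

/-- Gödel numbers of intervals. -/
def code : TimeInterval → ℕ
  | Icc a b => Nat.pair 0 (Nat.pair a b)
  | Ico a b => Nat.pair 1 (Nat.pair a b)
  | Ioc a b => Nat.pair 2 (Nat.pair a b)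
  | Ioo a b => Nat.pair 3 (Nat.pair a b)
  | Ici a => Nat.pair 4 a
  | Ioi a => Nat.pair 5 a

end TimeInterval

/-- MTL formulae over the alphabet `S`. -/
inductive MTL (S : Type) where
  | letter (a : S)
  | neg (φ : MTL S)
  | conj (φ ψ : MTL S)
  | untl (I : TimeInterval) (φ ψ : MTL S)

namespace MTL

/-- Pointwise semantics with strict until: `φ.SatAt w i` is `(w, i) ⊨ φ`
(positions are counted from `0`). -/
def SatAt {S : Type} (w : TimedWord S) : MTL S → Fin w.len → Prop
  | letter a, i => w.letter i = a
  | neg φ, i => ¬ φ.SatAt w i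
  | conj φ ψ, i => φ.SatAt w i ∧ ψ.SatAt w i
  | untl I φ ψ, i => ∃ j, i < j ∧ ψ.SatAt w j ∧ ((w.time j : ℝ) - (w.time i : ℝ)) ∈ I.toSet ∧
      ∀ k, i < k → k < j → φ.SatAt w k

/-- `w ⊨ φ`. -/
def Sat {S : Type} (φ : MTL S) (w : TimedWord S) : Prop := φ.SatAt w ⟨0, w.len_pos⟩

/-- Gödel numbers of formulae over the alphabet `{0, …, σ - 1}`. -/
def code {σ : ℕ} : MTL (Fin σ) → ℕ
  | letter a => Nat.pair 0 a
  | neg φ => Nat.pair 1 φ.code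
  | conj φ ψ => Nat.pair 2 (Nat.pair φ.code ψ.code)
  | untl I φ ψ => Nat.pair 3 (Nat.pair I.code (Nat.pair φ.code ψ.code))

end MTL

/-! ### The model checking problem as a computational problem -/

/-- An input: a parametric timed automaton and an MTL formula over the same finite alphabet.
The alphabet, the locations, the clocks and the parameters are numbered. -/
structure MCInput where
  numLetters : ℕ
  numLocs : ℕ
  numClocks : ℕ
  numParams : ℕ
  aut : PTA (Fin numLetters) (Fin numLocs) (Fin numClocks) (Fin numParams)
  spec : MTL (Fin numLetters)

/-- A subset of `{0, …, n - 1}` written as a bit vector. -/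
def bitVector {n : ℕ} (s : Finset (Fin n)) : List Bool :=
  List.ofFn fun i => decide (i ∈ s)

/-- Atomic constraints, written as finite data. -/
abbrev AtomCode := ℕ × ℕ × (ℕ ⊕ ℕ)

/-- Edges, written as finite data. -/
abbrev EdgeCode := ℕ × ℕ × List AtomCode × List Bool × ℕ

/-- Inputs of the model checking problem, written as finite data. -/
abbrev MCCode :=
  (ℕ × ℕ × ℕ × ℕ) × (List Bool × List EdgeCode × List Bool) × ℕ

def ClockAtom.code {n m : ℕ} (g : ClockAtom (Fin n) (Fin m)) : AtomCode :=
  (g.clock, g.cmp.code, Sum.map id Fin.val g.bound)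

def PTAEdge.code {σ l n m : ℕ} (e : PTAEdge (Fin σ) (Fin l) (Fin n) (Fin m)) : EdgeCode :=
  (e.src, e.label, e.guard.map ClockAtom.code, bitVector e.reset, e.tgt)

namespace MCInput

/-- The finite description of an input that an algorithm is given. -/
def code (I : MCInput) : MCCode :=
  ((I.numLetters, I.numLocs, I.numClocks, I.numParams),
    (bitVector I.aut.init, I.aut.edges.map PTAEdge.code, bitVector I.aut.final),
    I.spec.code)

/-- The question: is there a parameter valuation under which every timed word accepted by the
automaton satisfies the formula? -/
def Holds (I : MCInput) : Prop :=
  ∃ pv : ParamVal (Fin I.numParams), ∀ w ∈ I.aut.language pv, I.spec.Sat w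

end MCInput

/-- Some algorithm (a partial recursive function) halts on every input from `D`, and answers
correctly there. On all other data it may answer arbitrarily or not halt. -/
def MCDecidableOn (D : Set MCInput) : Prop :=
  ∃ f : MCCode →. Bool, Partrec f ∧ ∀ I ∈ D, ∃ b ∈ f I.code, (b = true ↔ I.Holds)

/-!
The halting problem of a stack machine `M` is reduced to the model checking problem.

The automaton `gridPTA` reads arbitrary letters at distance exactly `p`, where `p` is its
parameter. For `p = 1 / N` there are exactly `N` letters per time unit, so a timed word is a table
with rows of length `N`, and MTL can compare a letter with its right neighbour and with the letter
below it, at distance exactly one. No letter can be inserted between two points of the grid, and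
this is what makes exact comparisons with the previous row possible.

Row `t` of the table holds the configuration of `M` after `t` steps: entry `j` carries the state and
the elements at depth `j` of all stacks (`Tile`). A push shifts a stack by one to the right, a pop
by one to the left, so the transitions of `M` are a condition on four neighbouring letters
(`StackMachine.Compatible`). Rows are too short for the whole configuration in general. What is cut
off at the right end can only come back, after pops, at a speed of one entry per row, so the first
`N - t` entries of row `t` are correct in any case (`StackMachine.IsTableau.eq_iterate`). A diagonal
of marks ensures that a table has at least `N` rows. Hence:

* if `M` halts after `t` steps, there is no table with rows of length `t + 2` that avoids halting
  states (`StackMachine.exists_forall_not_isTableau`);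
* if `M` does not halt, there is such a table for every `N`
  (`StackMachine.isTableau_tableau`).

The formula `MTL.noTableau` says that the word is not such a table. It also fails on some word if `p`
is not of the form `1 / N`. Thus a parameter value for which all words satisfy it exists if and only
if `M` halts (`exists_paramVal_iff_halts`).

The machine is fixed. It is obtained from Mathlib's compilation of partial recursive functions to
multi-stack programs, by executing these programs one instruction at a time
(`exists_stackMachine_not_computablePred`). Only the part `MTL.firstRow` of the formula, which
describes the initial stacks, depends on the input of the machine; its Gödel number is computed
by recursion on the binary digits of the input.
-/

/-! ### Stack machines -/

/-- What a stack machine does to one of its stacks in one step. -/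
inductive StackOp (Γ : Type) where
  | keep
  | push (a : Γ)
  | pop

/-- The effect of a stack operation; the head of the list is the top of the stack. -/
def StackOp.apply {Γ : Type} : StackOp Γ → List Γ → List Γ
  | keep, l => l
  | push a, l => a :: l
  | pop, l => l.tail

/-- A deterministic machine with states `Q` and stacks indexed by `K`. The stack operations of a
step depend on the state only, the next state also depends on the tops of the stacks. A machine
keeps running after it has entered a halting state. -/
structure StackMachine (Q K Γ : Type) where
  op : Q → K → StackOp Γ
  next : Q → (K → Option Γ) → Q
  halting : Q → Prop

namespace StackMachine

variable {Q K Γ : Type}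

def step (M : StackMachine Q K Γ) (c : Q × (K → List Γ)) : Q × (K → List Γ) :=
  (M.next c.1 fun k => (c.2 k).head?, fun k => (M.op c.1 k).apply (c.2 k))

/-- The run from `c` enters a halting state within the first `t` steps. -/
def HaltsWithin (M : StackMachine Q K Γ) (t : ℕ) (c : Q × (K → List Γ)) : Prop :=
  ∃ s ≤ t, M.halting (M.step^[s] c).1

/-- The run from `c` enters a halting state. -/
def Halts (M : StackMachine Q K Γ) (c : Q × (K → List Γ)) : Prop :=
  ∃ s, M.halting (M.step^[s] c).1

theorem haltsWithin_zero {M : StackMachine Q K Γ} {c : Q × (K → List Γ)} :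
    M.HaltsWithin 0 c ↔ M.halting c.1 := by
  simp [HaltsWithin]

theorem haltsWithin_succ {M : StackMachine Q K Γ} {t : ℕ} {c : Q × (K → List Γ)} :
    M.HaltsWithin (t + 1) c ↔ M.halting c.1 ∨ M.HaltsWithin t (M.step c) := by
  constructor
  · rintro ⟨_ | s, hs, h⟩
    · exact Or.inl h
    · exact Or.inr ⟨s, by omega, h⟩
  · rintro (h | ⟨s, hs, h⟩)
    · exact ⟨0, by omega, h⟩
    · exact ⟨s + 1, by omega, h⟩

theorem halts_iff {M : StackMachine Q K Γ} {c : Q × (K → List Γ)} :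
    M.Halts c ↔ ∃ t, M.HaltsWithin t c :=
  ⟨fun ⟨s, h⟩ => ⟨s, s, le_rfl, h⟩, fun ⟨_, s, _, h⟩ => ⟨s, h⟩⟩

theorem halts_iff_step {M : StackMachine Q K Γ} {c : Q × (K → List Γ)} :
    M.Halts c ↔ M.halting c.1 ∨ M.Halts (M.step c) := by
  constructor
  · rintro ⟨_ | s, h⟩
    · exact Or.inl h
    · exact Or.inr ⟨s, h⟩
  · rintro (h | ⟨s, h⟩)
    · exact ⟨0, h⟩
    · exact ⟨s + 1, h⟩

/-- The restriction of a machine to a set of states that is closed under its transitions. -/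
def restrict (M : StackMachine Q K Γ) (p : Q → Prop) (hp : ∀ q, p q → ∀ s, p (M.next q s)) :
    StackMachine {q // p q} K Γ where
  op q := M.op q
  next q s := ⟨M.next q s, hp q q.2 s⟩
  halting q := M.halting q

theorem restrict_halts_iff (M : StackMachine Q K Γ) (p : Q → Prop)
    (hp : ∀ q, p q → ∀ s, p (M.next q s)) (q : {q // p q}) (S : K → List Γ) :
    (M.restrict p hp).Halts (q, S) ↔ M.Halts (q.1, S) := by
  have key : ∀ t, Prod.map Subtype.val id ((M.restrict p hp).step^[t] (q, S)) =
      M.step^[t] (q.1, S) := by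
    intro t
    induction t with
    | zero => rfl
    | succ t ih =>
      rw [Function.iterate_succ_apply', Function.iterate_succ_apply', ← ih]
      rfl
  unfold Halts
  simp_rw [← key]
  rfl

end StackMachine

/-! ### Executing the statements of a multi-stack program one at a time -/

namespace Turing.TM2

open Stmt

variable {K Γ Λ σ : Type}

theorem mem_stmts_of_mem {M : Λ → Stmt (fun _ : K => Γ) Λ σ} {S : Finset Λ} {l : Λ}
    (h : l ∈ S) : some (M l) ∈ stmts M S := by
  simp only [stmts, Finset.some_mem_insertNone, Finset.mem_biUnion]
  exact ⟨l, h, stmts₁_self⟩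

variable [DecidableEq K]

/-- The stack machine that executes a `TM2` program by performing one elementary instruction per
step. Its states are the statements that remain to be executed, with the value of the internal
store; it halts at the statement `halt`. -/
def stackMachine (M : Λ → Stmt (fun _ : K => Γ) Λ σ) :
    StackMachine (Stmt (fun _ : K => Γ) Λ σ × σ) K Γ where
  op
    | (push k f _, v), k' => if k' = k then .push (f v) else .keep
    | (pop k _ _, _), k' => if k' = k then .pop else .keep
    | _, _ => .keep
  next
    | (push _ _ q, v), _ => (q, v)
    | (peek k f q, v), s => (q, f v (s k))
    | (pop k f q, v), s => (q, f v (s k))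
    | (load a q, v), _ => (q, a v)
    | (branch f q₁ q₂, v), _ => (cond (f v) q₁ q₂, v)
    | (goto l, v), _ => (M (l v), v)
    | (halt, v), _ => (halt, v)
  halting
    | (halt, _) => True
    | _ => False

/-- The substatements of the labels in a supporting set are closed under the transitions, so that
the stack machine can be restricted to finitely many states. -/
theorem mem_stmts_stackMachine_next [Inhabited Λ] {M : Λ → Stmt (fun _ : K => Γ) Λ σ}
    {S : Finset Λ} (hS : Supports M S) (q : Stmt (fun _ : K => Γ) Λ σ × σ)
    (hq : some q.1 ∈ stmts M S) (s : K → Option Γ) :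
    some ((stackMachine M).next q s).1 ∈ stmts M S := by
  obtain ⟨q, v⟩ := q
  cases q with
  | push k f q | peek k f q | pop k f q | load a q =>
    exact stmts_trans (by simp [stackMachine, stmts₁, stmts₁_self]) hq
  | branch f q₁ q₂ =>
    refine stmts_trans ?_ hq
    cases h : f v <;> simp [stackMachine, stmts₁, stmts₁_self, h]
  | goto l =>
    have h := stmts_supportsStmt hS hq v
    simp only [stackMachine, stmts, Finset.some_mem_insertNone, Finset.mem_biUnion]
    exact ⟨_, h, stmts₁_self⟩
  | halt => exact hq

theorem stackMachine_step_push (M : Λ → Stmt (fun _ : K => Γ) Λ σ) (k : K) (f : σ → Γ)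
    (q : Stmt (fun _ : K => Γ) Λ σ) (v : σ) (S : K → List Γ) :
    (stackMachine M).step ((push k f q, v), S) =
      ((q, v), Function.update S k (f v :: S k)) := by
  refine Prod.ext rfl (funext fun k' => ?_)
  by_cases h : k' = k
  · subst h
    simp [StackMachine.step, stackMachine, StackOp.apply]
  · simp [StackMachine.step, stackMachine, StackOp.apply, h]

theorem stackMachine_step_pop (M : Λ → Stmt (fun _ : K => Γ) Λ σ) (k : K)
    (f : σ → Option Γ → σ) (q : Stmt (fun _ : K => Γ) Λ σ) (v : σ) (S : K → List Γ) :
    (stackMachine M).step ((pop k f q, v), S) =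
      ((q, f v (S k).head?), Function.update S k (S k).tail) := by
  refine Prod.ext rfl (funext fun k' => ?_)
  by_cases h : k' = k
  · subst h
    simp [StackMachine.step, stackMachine, StackOp.apply]
  · simp [StackMachine.step, stackMachine, StackOp.apply, h]

/-- Each label visited by the `TM2` program costs the stack machine at least one step. -/
theorem exists_lt_haltsWithin_of_haltsWithin {M : Λ → Stmt (fun _ : K => Γ) Λ σ} {t : ℕ}
    {q : Stmt (fun _ : K => Γ) Λ σ} {v : σ} {S : K → List Γ}
    (h : (stackMachine M).HaltsWithin t ((q, v), S)) {l : Λ} (hl : (stepAux q v S).l = some l) :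
    ∃ t' < t, (stackMachine M).HaltsWithin t'
      ((M l, (stepAux q v S).var), (stepAux q v S).stk) := by
  induction q generalizing t v S with
  | halt => simp at hl
  | goto f =>
    obtain _ | t := t
    · exact (StackMachine.haltsWithin_zero.1 h).elim
    · obtain h | h := StackMachine.haltsWithin_succ.1 h
      · exact h.elim
      · obtain rfl : f v = l := by simpa using hl
        exact ⟨t, t.lt_succ_self, h⟩
  | push k f q ih =>
    obtain _ | t := t
    · exact (StackMachine.haltsWithin_zero.1 h).elim
    · obtain h | h := StackMachine.haltsWithin_succ.1 h
      · exact h.elim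
      · rw [stackMachine_step_push] at h
        obtain ⟨t', ht, h'⟩ := ih h hl
        exact ⟨t', ht.trans t.lt_succ_self, h'⟩
  | pop k f q ih =>
    obtain _ | t := t
    · exact (StackMachine.haltsWithin_zero.1 h).elim
    · obtain h | h := StackMachine.haltsWithin_succ.1 h
      · exact h.elim
      · rw [stackMachine_step_pop] at h
        obtain ⟨t', ht, h'⟩ := ih h hl
        exact ⟨t', ht.trans t.lt_succ_self, h'⟩
  | peek k f q ih | load a q ih =>
    obtain _ | t := t
    · exact (StackMachine.haltsWithin_zero.1 h).elim
    · obtain h | h := StackMachine.haltsWithin_succ.1 h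
      · exact h.elim
      · obtain ⟨t', ht, h'⟩ := ih h hl
        exact ⟨t', ht.trans t.lt_succ_self, h'⟩
  | branch f q₁ q₂ ih₁ ih₂ =>
    obtain _ | t := t
    · exact (StackMachine.haltsWithin_zero.1 h).elim
    · obtain h | h := StackMachine.haltsWithin_succ.1 h
      · exact h.elim
      · change StackMachine.HaltsWithin _ t ((cond (f v) q₁ q₂, v), S) at h
        rw [stepAux] at hl ⊢
        cases hf : f v <;> rw [hf] at h hl
        · obtain ⟨t', ht, h'⟩ := ih₂ h hl
          exact ⟨t', ht.trans t.lt_succ_self, h'⟩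
        · obtain ⟨t', ht, h'⟩ := ih₁ h hl
          exact ⟨t', ht.trans t.lt_succ_self, h'⟩

/-- If the `TM2` program halts after the statement `q`, or the stack machine halts from the label
that `q` jumps to, then the stack machine halts from `q`. -/
theorem halts_of_stepAux {M : Λ → Stmt (fun _ : K => Γ) Λ σ}
    {q : Stmt (fun _ : K => Γ) Λ σ} {v : σ} {S : K → List Γ}
    (h : ∀ l, (stepAux q v S).l = some l →
      (stackMachine M).Halts ((M l, (stepAux q v S).var), (stepAux q v S).stk)) :
    (stackMachine M).Halts ((q, v), S) := by
  induction q generalizing v S with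
  | halt => exact ⟨0, trivial⟩
  | goto f => exact StackMachine.halts_iff_step.2 (Or.inr (h _ rfl))
  | push k f q ih =>
    rw [StackMachine.halts_iff_step, stackMachine_step_push]
    exact Or.inr (ih h)
  | pop k f q ih =>
    rw [StackMachine.halts_iff_step, stackMachine_step_pop]
    exact Or.inr (ih h)
  | peek k f q ih | load a q ih =>
    exact StackMachine.halts_iff_step.2 (Or.inr (ih h))
  | branch f q₁ q₂ ih₁ ih₂ =>
    refine StackMachine.halts_iff_step.2 (Or.inr ?_)
    change StackMachine.Halts _ ((cond (f v) q₁ q₂, v), S)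
    rw [stepAux] at h
    cases hf : f v <;> rw [hf] at h
    · exact ih₂ h
    · exact ih₁ h

theorem stackMachine_halts_iff (M : Λ → Stmt (fun _ : K => Γ) Λ σ) (l : Λ) (v : σ)
    (S : K → List Γ) :
    (stackMachine M).Halts ((M l, v), S) ↔ (StateTransition.eval (step M) ⟨some l, v, S⟩).Dom := by
  constructor
  · rw [StackMachine.halts_iff]
    rintro ⟨t, ht⟩
    induction t using Nat.strong_induction_on generalizing l v S with
    | _ t ih =>
      have h₁ : StateTransition.Reaches (step M) ⟨some l, v, S⟩ (stepAux (M l) v S) :=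
        Relation.ReflTransGen.single rfl
      rw [StateTransition.reaches_eval h₁]
      have hl := fun l' => exists_lt_haltsWithin_of_haltsWithin (l := l') ht
      clear h₁
      generalize stepAux (M l) v S = b at hl ⊢
      obtain ⟨l', v', S'⟩ := b
      cases l' with
      | none =>
        exact Part.dom_iff_mem.2 ⟨_, StateTransition.mem_eval.2 ⟨Relation.ReflTransGen.refl, rfl⟩⟩
      | some l' =>
        obtain ⟨t', ht', h'⟩ := hl l' rfl
        exact ih t' ht' _ _ _ h'
  · intro h
    obtain ⟨c', hc'⟩ := Part.dom_iff_mem.1 h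
    obtain ⟨hr, hn⟩ := StateTransition.mem_eval.1 hc'
    have key : ∀ c, StateTransition.Reaches (step M) c c' → ∀ l, c.l = some l →
        (stackMachine M).Halts ((M l, c.var), c.stk) := by
      intro c hc
      induction hc using Relation.ReflTransGen.head_induction_on with
      | refl =>
        rintro l hl
        obtain ⟨l', v', S'⟩ := c'
        obtain rfl : l' = some l := hl
        simp at hn
      | @head a b h₁ _ ih =>
        rintro l hl
        obtain ⟨_, v', S'⟩ := a
        cases hl
        obtain rfl : stepAux (M l) v' S' = b := by simpa using h₁
        exact halts_of_stepAux ih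
    exact key _ hr l rfl

end Turing.TM2

/-! ### A stack machine with an undecidable halting problem -/

open Turing Turing.PartrecToTM2 in
/-- Some stack machine with finitely many states, run on the binary representations of the natural
numbers, has an undecidable halting problem: it decides whether the `n`-th code halts on `0`. -/
theorem exists_stackMachine_not_computablePred :
    ∃ (Q : Type) (_ : Finite Q) (M : StackMachine Q K' Γ') (q₀ : Q),
      ¬ ComputablePred fun n : ℕ => M.Halts (q₀, K'.elim (trList [n]) [] [] []) := by
  classical
  let g : ℕ →. ℕ := fun n => Nat.Partrec.Code.eval (Denumerable.ofNat Nat.Partrec.Code n) 0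
  have hg : Partrec g :=
    Nat.Partrec.Code.eval_part.comp (Computable.ofNat _) (Computable.const 0)
  obtain ⟨c, hc⟩ := ToPartrec.Code.exists_code (Nat.Partrec'.part_iff₁.2 hg)
  let start := trNormal c Cont'.halt
  let S := codeSupp c Cont'.halt
  let _ : Inhabited Λ' := ⟨start⟩
  have hS : TM2.Supports tr S := tr_supports c Cont'.halt
  let p : TM2.Stmt (fun _ : K' => Γ') Λ' (Option Γ') × Option Γ' → Prop :=
    fun q => some q.1 ∈ TM2.stmts tr S
  have hp : ∀ q, p q → ∀ s, p ((TM2.stackMachine tr).next q s) :=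
    TM2.mem_stmts_stackMachine_next hS
  have hfin : Finite {q // p q} := by
    have h₁ : Set.Finite {s : TM2.Stmt (fun _ : K' => Γ') Λ' (Option Γ') |
        some s ∈ TM2.stmts tr S} :=
      Set.Finite.preimage (Option.some_injective _).injOn (TM2.stmts tr S).finite_toSet
    exact ((h₁.prod (Set.finite_univ (α := Option Γ'))).subset fun q hq => ⟨hq, trivial⟩).to_subtype
  refine ⟨{q // p q}, hfin, (TM2.stackMachine tr).restrict p hp,
    ⟨(tr start, none), TM2.mem_stmts_of_mem hS.1⟩, fun h => ?_⟩
  refine ComputablePred.halting_problem 0 ?_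
  obtain ⟨_, h⟩ := h
  refine ⟨fun _ => Classical.dec _, (h.comp Computable.encode).of_eq fun a => ?_⟩
  rw [decide_eq_decide]
  refine (StackMachine.restrict_halts_iff _ p hp _ _).trans
    ((TM2.stackMachine_halts_iff _ _ _ _).trans ?_)
  have h₁ := tr_eval c [Encodable.encode a]
  have h₂ := hc (Encodable.encode a ::ᵥ List.Vector.nil)
  change c.eval [Encodable.encode a] = _ at h₂
  rw [h₂] at h₁
  refine (iff_of_eq (congrArg Part.Dom h₁)).trans ?_
  simp [g]

/-! ### Tableaux of runs -/

/-- The entries of a tableau: the state of the machine, one entry of every stack, and two marks. -/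
@[ext]
structure Tile (Q K Γ : Type) where
  state : Q
  content : K → Option Γ
  rowStart : Bool
  diagonal : Bool

instance {Q K Γ : Type} [Finite Q] [Finite K] [Finite Γ] : Finite (Tile Q K Γ) :=
  Finite.of_injective (β := Q × (K → Option Γ) × Bool × Bool)
    (fun a => (a.state, a.content, a.rowStart, a.diagonal)) fun a b h => by
      simp only [Prod.mk.injEq] at h
      exact Tile.ext h.1 h.2.1 h.2.2.1 h.2.2.2

/-- The entries at depth `j` of a family of stacks. -/
def layer {K Γ : Type} (S : K → List Γ) (j : ℕ) : K → Option Γ := fun k => (S k)[j]?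

namespace StackMachine

variable {Q K Γ : Type}

/-- The local condition on a tableau with rows of length `N`: here `a`, `b`, `c`, `d` are its
entries at the positions `i`, `i + 1`, `i + N`, `i + N + 1`. A pop leaves the last entry of the
next row unconstrained, and a push drops the last entry of the row. -/
structure Compatible (M : StackMachine Q K Γ) (a b c d : Tile Q K Γ) : Prop where
  state_right : b.rowStart = false → b.state = a.state
  state_below : a.rowStart = true → c.state = M.next a.state a.content
  keep : ∀ k, M.op a.state k = .keep → c.content k = a.content k
  push_top : ∀ k x, M.op a.state k = .push x → a.rowStart = true → c.content k = some x
  push_shift : ∀ k x, M.op a.state k = .push x → b.rowStart = false → d.content k = a.content k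
  pop : ∀ k, M.op a.state k = .pop → b.rowStart = false → c.content k = b.content k
  blank_right : ∀ k, b.rowStart = false → a.content k = none → b.content k = none
  rowStart_below : c.rowStart = a.rowStart
  diagonal_above : d.diagonal = true → a.diagonal = true
  not_halting : ¬ M.halting a.state

/-- The first `len` entries of `u` form the beginning of a tableau, with rows of length `N`, of the
run of `M` that starts in state `q₀` with stacks `S`. The stacks have at most `L` elements. The
diagonal marks, at distance `N + 1`, force the tableau to have at least `N` rows. -/
structure IsTableau (M : StackMachine Q K Γ) (q₀ : Q) (S : K → List Γ) (L N len : ℕ)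
    (u : ℕ → Tile Q K Γ) : Prop where
  first_state : (u 0).state = q₀
  first_rowStart : (u 0).rowStart = true
  first_row : ∀ j < N, j ≤ L → (u j).content = layer S j
  not_rowStart : ∀ j, 0 < j → j < N → j < len → (u j).rowStart = false
  not_diagonal : ∀ j, 0 < j → j ≤ N → j < len → (u j).diagonal = false
  compatible : ∀ i, i + N + 1 < len → M.Compatible (u i) (u (i + 1)) (u (i + N)) (u (i + N + 1))
  long : ∃ i, i + 2 < len ∧ (u i).diagonal = true ∧ (u (i + 1)).rowStart = true

theorem layer_step (M : StackMachine Q K Γ) (c : Q × (K → List Γ)) (j : ℕ) (k : K) :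
    layer (M.step c).2 j k = ((M.op c.1 k).apply (c.2 k))[j]? := rfl

theorem step_fst (M : StackMachine Q K Γ) (c : Q × (K → List Γ)) :
    (M.step c).1 = M.next c.1 (layer c.2 0) := by
  simp only [step, List.head?_eq_getElem?]
  rfl

namespace IsTableau

variable {M : StackMachine Q K Γ} {q₀ : Q} {S : K → List Γ} {L N len : ℕ} {u : ℕ → Tile Q K Γ}

theorem rowStart_iff (h : M.IsTableau q₀ S L N len u) (hN : 0 < N) (i : ℕ) (hi : i + 1 < len) :
    (u i).rowStart = true ↔ N ∣ i := by
  induction i using Nat.strong_induction_on with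
  | _ i ih =>
    obtain rfl | h0 := Nat.eq_zero_or_pos i
    · simp [h.first_rowStart]
    obtain hlt | hle := lt_or_ge i N
    · rw [h.not_rowStart i h0 hlt (by omega)]
      simpa using Nat.not_dvd_of_pos_of_lt h0 hlt
    · obtain ⟨m, rfl⟩ := Nat.exists_eq_add_of_le' hle
      rw [(h.compatible m (by omega)).rowStart_below, ih m (by omega) (by omega)]
      simp

/-- The marks on the diagonal are at multiples of `N + 1`. The first one that is followed by the
start of a row is thus the one in the last entry of row `N - 1`. -/
theorem dvd_of_diagonal (h : M.IsTableau q₀ S L N len u) (i : ℕ) (hi : i < len)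
    (hd : (u i).diagonal = true) : N + 1 ∣ i := by
  induction i using Nat.strong_induction_on with
  | _ i ih =>
    obtain rfl | h0 := Nat.eq_zero_or_pos i
    · simp
    obtain hle | hlt := le_or_gt i N
    · simp [h.not_diagonal i h0 hle hi] at hd
    · obtain ⟨m, rfl⟩ := Nat.exists_eq_add_of_le' (Nat.succ_le_of_lt hlt)
      have := ih m (by omega) (by omega) ((h.compatible m (by omega)).diagonal_above hd)
      simpa using this

theorem sq_lt_len (h : M.IsTableau q₀ S L N len u) (hN : 0 < N) : N * N < len := by
  obtain ⟨i, hi, hd, hs⟩ := h.long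
  obtain ⟨s, rfl⟩ := h.dvd_of_diagonal i (by omega) hd
  have h₁ : N ∣ s + 1 := by
    have h₂ := (h.rowStart_iff hN _ (by omega)).1 hs
    rw [show (N + 1) * s + 1 = N * s + (s + 1) by ring] at h₂
    exact (Nat.dvd_add_right (Dvd.intro _ rfl)).1 h₂
  have := Nat.le_of_dvd (by omega) h₁
  nlinarith

theorem rowStart_mul_add (h : M.IsTableau q₀ S L N len u) {t j : ℕ} (hj : j < N)
    (hi : t * N + j + 1 < len) : (u (t * N + j)).rowStart = decide (j = 0) := by
  rw [Bool.eq_iff_iff, h.rowStart_iff (by omega) _ hi, Nat.dvd_add_right (Dvd.intro_left _ rfl),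
    decide_eq_true_iff]
  exact ⟨fun hd => Nat.eq_zero_of_dvd_of_lt hd hj, fun h0 => h0 ▸ dvd_zero _⟩

theorem state_eq_of_rowStart (h : M.IsTableau q₀ S L N len u) {t j : ℕ} (hj : j < N)
    (hi : t * N + N + N < len) : (u (t * N + j)).state = (u (t * N)).state := by
  induction j with
  | zero => rfl
  | succ j ih =>
    rw [← ih (by omega)]
    refine (h.compatible (t * N + j) (by omega)).state_right ?_
    rw [add_assoc, h.rowStart_mul_add hj (by omega)]
    simp

/-- As long as the run has not halted, row `t` of a tableau describes the configuration after `t`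
steps. The arbitrary entries that pops create at the end of the rows move to the left by at
most one entry per row, so they do not reach the first `N - t` entries. -/
theorem eq_iterate (h : M.IsTableau q₀ S L N len u) (hS : ∀ k, (S k).length ≤ L) (t : ℕ)
    (ht : t + 2 ≤ N) :
    (∀ j < N, (u (t * N + j)).state = (M.step^[t] (q₀, S)).1) ∧
      ∀ j, t + j < N → (u (t * N + j)).content = layer (M.step^[t] (q₀, S)).2 j := by
  have hlen := h.sq_lt_len (by omega)
  have hbound : ∀ t, t + 2 ≤ N → t * N + N + N < len := fun t ht => by nlinarith
  induction t with
  | zero =>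
    have hb := hbound 0 ht
    refine ⟨fun j hj => (h.state_eq_of_rowStart hj hb).trans ?_, fun j => ?_⟩
    · simpa using h.first_state
    · rw [zero_add, zero_mul, zero_add]
      change _ → _ = layer S j
      induction j with
      | zero => exact fun hj => h.first_row 0 hj (Nat.zero_le _)
      | succ j ih =>
        intro hj
        obtain hle | hlt := le_or_gt (j + 1) L
        · exact h.first_row _ hj hle
        · funext k
          have hk : ∀ m, L ≤ m → layer S m k = none := fun m hm =>
            List.getElem?_eq_none ((hS k).trans hm)
          rw [hk _ hlt.le]
          refine (h.compatible j (by omega)).blank_right k ?_ ?_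
          · exact h.not_rowStart _ (by omega) hj (by omega)
          · rw [ih (by omega), hk _ (by omega)]
  | succ t ih =>
    obtain ⟨ih₁, ih₂⟩ := ih (by omega)
    have hb := hbound t (by omega)
    have hb' := hbound (t + 1) ht
    have hmul : (t + 1) * N = t * N + N := by ring
    rw [Function.iterate_succ_apply']
    set c := M.step^[t] (q₀, S) with hc
    have hcomp : ∀ j < N, M.Compatible (u (t * N + j)) (u (t * N + j + 1))
        (u ((t + 1) * N + j)) (u ((t + 1) * N + j + 1)) := fun j hj => by
      have := h.compatible (t * N + j) (by omega)
      rwa [show t * N + j + N = (t + 1) * N + j by rw [hmul]; omega] at this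
    have hstart : ∀ j < N, (u (t * N + j)).rowStart = decide (j = 0) := fun j hj =>
      h.rowStart_mul_add hj (by omega)
    have hright : ∀ j, j + 1 < N → (u (t * N + j + 1)).rowStart = false := fun j hj => by
      rw [add_assoc, hstart _ hj]
      simp
    refine ⟨fun j hj => (h.state_eq_of_rowStart hj hb').trans ?_, fun j hj => funext fun k => ?_⟩
    · have := (hcomp 0 (by omega)).state_below (hstart 0 (by omega))
      rw [ih₁ 0 (by omega), ih₂ 0 (by omega)] at this
      rw [step_fst]
      exact this
    · rw [layer_step]
      have hop := ih₁ j (by omega)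
      cases hk : M.op c.1 k with
      | keep =>
        rw [(hcomp j (by omega)).keep k (by rw [hop, hk]), ih₂ j (by omega)]
        rfl
      | push x =>
        cases j with
        | zero =>
          exact (hcomp 0 (by omega)).push_top k x (by rw [hop, hk])
            (hstart 0 (by omega))
        | succ j =>
          rw [← add_assoc, (hcomp j (by omega)).push_shift k x (by rw [ih₁ j (by omega), hk])
            (hright j (by omega)), ih₂ j (by omega)]
          rfl
      | pop =>
        rw [(hcomp j (by omega)).pop k (by rw [hop, hk]) (hright j (by omega)), add_assoc,
          ih₂ (j + 1) (by omega)]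
        simp [layer, StackOp.apply]

end IsTableau

theorem exists_forall_not_isTableau {M : StackMachine Q K Γ} {q₀ : Q} {S : K → List Γ} {L : ℕ}
    (hS : ∀ k, (S k).length ≤ L) (hM : M.Halts (q₀, S)) :
    ∃ N, 0 < N ∧ ∀ len u, ¬ M.IsTableau q₀ S L N len u := by
  obtain ⟨t, ht⟩ := hM
  -- Row `t` has to be correct, and the local condition at its first entry has to be within reach.
  refine ⟨t + 2, by omega, fun len u h => ?_⟩
  have hlen := h.sq_lt_len (by omega)
  refine (h.compatible (t * (t + 2)) (by nlinarith)).not_halting ?_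
  have := (h.eq_iterate hS t le_rfl).1 0 (by omega)
  rw [add_zero] at this
  rwa [this]

/-- The tableau with rows of length `N` of the run from `c`. -/
def tableau (M : StackMachine Q K Γ) (c : Q × (K → List Γ)) (N i : ℕ) : Tile Q K Γ where
  state := (M.step^[i / N] c).1
  content := layer (M.step^[i / N] c).2 (i % N)
  rowStart := decide (i % N = 0)
  diagonal := decide (N + 1 ∣ i)

theorem compatible_tableau {M : StackMachine Q K Γ} {c : Q × (K → List Γ)} (hM : ¬ M.Halts c)
    {N : ℕ} (hN : 0 < N) (i : ℕ) :
    M.Compatible (M.tableau c N i) (M.tableau c N (i + 1)) (M.tableau c N (i + N))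
      (M.tableau c N (i + N + 1)) := by
  have hdiv : (i + N) / N = i / N + 1 := Nat.add_div_right i hN
  have hmod : (i + N) % N = i % N := Nat.add_mod_right i N
  have hr : ∀ m, (M.tableau c N (m + 1)).rowStart = false →
      (m + 1) / N = m / N ∧ (m + 1) % N = m % N + 1 := by
    intro m hm
    have hm' : (m + 1) % N ≠ 0 := by simpa [tableau] using hm
    have h₁ : ¬ N ∣ m + 1 := fun hd => hm' (Nat.mod_eq_zero_of_dvd hd)
    have h₂ : (m + 1) / N = m / N := Nat.succ_div_of_not_dvd h₁
    have h₃ := Nat.div_add_mod m N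
    have h₄ := Nat.div_add_mod (m + 1) N
    rw [h₂] at h₄
    exact ⟨h₂, by omega⟩
  have hr' : (M.tableau c N (i + 1)).rowStart = false →
      (i + N + 1) / N = i / N + 1 ∧ (i + N + 1) % N = i % N + 1 := by
    intro h
    obtain ⟨h₁, h₂⟩ := hr i h
    rw [add_right_comm]
    exact ⟨by rw [Nat.add_div_right _ hN, h₁], by rw [Nat.add_mod_right, h₂]⟩
  have hbelow : (M.tableau c N (i + N)).content =
      layer (M.step (M.step^[i / N] c)).2 (i % N) := by
    simp only [tableau]
    rw [hdiv, hmod, Function.iterate_succ_apply']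
  refine ⟨fun h => ?_, fun h => ?_, fun k h => ?_, fun k x h h₀ => ?_, fun k x h h₁ => ?_,
    fun k h h₁ => ?_, fun k h h₁ => ?_, ?_, fun h => ?_, fun h => hM ⟨_, h⟩⟩
  · simp only [tableau, (hr i h).1]
  · have h0 : i % N = 0 := by simpa [tableau] using h
    simp only [tableau]
    rw [hdiv, h0, Function.iterate_succ_apply', step_fst]
  · have h' : M.op (M.step^[i / N] c).1 k = .keep := h
    rw [hbelow, layer_step, h']
    rfl
  · have h0 : i % N = 0 := by simpa [tableau] using h₀
    have h' : M.op (M.step^[i / N] c).1 k = .push x := h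
    rw [hbelow, layer_step, h', h0]
    rfl
  · have h' : M.op (M.step^[i / N] c).1 k = .push x := h
    simp only [tableau]
    rw [(hr' h₁).1, (hr' h₁).2, Function.iterate_succ_apply', layer_step, h']
    rfl
  · have h' : M.op (M.step^[i / N] c).1 k = .pop := h
    rw [hbelow, layer_step, h']
    simp only [tableau]
    rw [(hr i h₁).1, (hr i h₁).2]
    simp [layer, StackOp.apply]
  · have h₂ : ((M.step^[i / N] c).2 k)[i % N]? = none := h₁
    simp only [tableau]
    rw [(hr i h).1, (hr i h).2]
    simp only [layer, List.getElem?_eq_none_iff] at h₂ ⊢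
    omega
  · simp only [tableau, hmod]
  · simpa [tableau, add_assoc] using h

theorem isTableau_tableau {M : StackMachine Q K Γ} {q₀ : Q} {S : K → List Γ}
    (hM : ¬ M.Halts (q₀, S)) (L : ℕ) {N : ℕ} (hN : 0 < N) {len : ℕ} (hlen : N * N + 1 < len) :
    M.IsTableau q₀ S L N len (M.tableau (q₀, S) N) where
  first_state := by simp [tableau]
  first_rowStart := by simp [tableau]
  first_row j hj _ := by simp [tableau, Nat.div_eq_of_lt hj, Nat.mod_eq_of_lt hj]
  not_rowStart j h0 hj _ := by simp [tableau, Nat.mod_eq_of_lt hj, h0.ne']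
  not_diagonal j h0 hj _ := by
    simpa [tableau] using Nat.not_dvd_of_pos_of_lt h0 (Nat.lt_succ_of_le hj)
  compatible i _ := compatible_tableau hM hN i
  long := by
    obtain ⟨m, rfl⟩ := Nat.exists_eq_add_of_lt hN
    have e : (0 + m + 1 + 1) * m + 1 = (0 + m + 1) * (0 + m + 1) := by ring
    refine ⟨(0 + m + 1 + 1) * m, by omega, by simp [tableau], ?_⟩
    rw [e]
    simp [tableau]

end StackMachine

/-! ### Derived operators of metric temporal logic -/

namespace MTL

section Operators

variable {S : Type}

def disj (φ ψ : MTL S) : MTL S := neg (conj (neg φ) (neg ψ))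

theorem satAt_disj {w : TimedWord S} {i : Fin w.len} {φ ψ : MTL S} :
    (disj φ ψ).SatAt w i ↔ φ.SatAt w i ∨ ψ.SatAt w i := by
  simp only [disj, SatAt]
  tauto

theorem time_sub_mem_Ici_zero {w : TimedWord S} {i j : Fin w.len} (h : i ≤ j) :
    ((w.time j : ℝ) - (w.time i : ℝ)) ∈ (TimeInterval.Ici 0).toSet := by
  simpa [TimeInterval.toSet] using w.time_mono h

variable [Inhabited S]

def falsum : MTL S := conj (letter default) (neg (letter default))

def verum : MTL S := neg falsum

def anyOf (l : List (MTL S)) : MTL S := l.foldr disj falsum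

/-- The current letter has the property `p`. -/
noncomputable def letterIn [Fintype S] (p : S → Prop) : MTL S :=
  open Classical in anyOf ((Finset.univ.filter p).toList.map letter)

/-- `φ` holds at the next position, which exists. -/
def next (φ : MTL S) : MTL S := untl (.Ici 0) falsum φ

/-- `φ` holds at a later position whose distance in time lies in `I`. -/
def eventually (I : TimeInterval) (φ : MTL S) : MTL S := untl I verum φ

/-- `φ` holds at the current position or at a later one. -/
def sometime (φ : MTL S) : MTL S := disj φ (eventually (.Ici 0) φ)

variable {w : TimedWord S} {i : Fin w.len}

theorem not_satAt_falsum : ¬ falsum.SatAt w i := fun h => h.2 h.1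

theorem satAt_verum : verum.SatAt w i := not_satAt_falsum

theorem satAt_anyOf {l : List (MTL S)} : (anyOf l).SatAt w i ↔ ∃ φ ∈ l, φ.SatAt w i := by
  induction l with
  | nil => simpa [anyOf] using not_satAt_falsum
  | cons φ l ih =>
    change (disj φ (anyOf l)).SatAt w i ↔ _
    simp [satAt_disj, ih]

theorem satAt_letterIn [Fintype S] {p : S → Prop} :
    (letterIn p).SatAt w i ↔ p (w.letter i) := by
  simp [letterIn, satAt_anyOf, SatAt]

theorem satAt_eventually {I : TimeInterval} {φ : MTL S} : (eventually I φ).SatAt w i ↔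
    ∃ j, i < j ∧ φ.SatAt w j ∧ ((w.time j : ℝ) - (w.time i : ℝ)) ∈ I.toSet := by
  simp only [eventually, SatAt, satAt_verum]
  simp

/-- As `until` is strict, `falsum` as its left argument forces the witness to be the next
position. -/
theorem satAt_untl_falsum {I : TimeInterval} {φ : MTL S} : (untl I falsum φ).SatAt w i ↔
    ∃ h : i.val + 1 < w.len, φ.SatAt w ⟨i + 1, h⟩ ∧
      ((w.time ⟨i + 1, h⟩ : ℝ) - (w.time i : ℝ)) ∈ I.toSet := by
  simp only [SatAt, not_satAt_falsum]
  constructor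
  · rintro ⟨⟨j, hj⟩, hij, h₁, h₂, h₃⟩
    obtain rfl : j = i + 1 := by
      by_contra hne
      have hij' : i.val < j := hij
      exact h₃ ⟨i + 1, by omega⟩ (Fin.lt_def.2 (by simp)) (Fin.lt_def.2 (by simp only; omega))
    exact ⟨hj, h₁, h₂⟩
  · rintro ⟨h, h₁, h₂⟩
    exact ⟨_, Fin.lt_def.2 (by simp), h₁, h₂, fun k hk hk' => by
      simp only [Fin.lt_def] at hk hk'
      omega⟩

theorem satAt_next {φ : MTL S} :
    (next φ).SatAt w i ↔ ∃ h : i.val + 1 < w.len, φ.SatAt w ⟨i + 1, h⟩ := by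
  rw [next, satAt_untl_falsum]
  refine exists_congr fun h => and_iff_left (time_sub_mem_Ici_zero (Fin.le_def.2 (by simp)))

theorem sat_sometime {φ : MTL S} : (sometime φ).Sat w ↔ ∃ j, φ.SatAt w j := by
  rw [Sat, sometime, satAt_disj, satAt_eventually]
  constructor
  · rintro (h | ⟨j, -, h, -⟩)
    exacts [⟨_, h⟩, ⟨_, h⟩]
  · rintro ⟨⟨j, hj⟩, h⟩
    obtain rfl | h0 := Nat.eq_zero_or_pos j
    · exact Or.inl h
    · exact Or.inr ⟨_, Fin.lt_def.2 h0, h, time_sub_mem_Ici_zero (Fin.le_def.2 h0.le)⟩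

end Operators

end MTL

/-! ### Evenly spaced timed words -/

/-- The time between consecutive letters, and before the first letter, is `p`. -/
def TimedWord.EvenlySpaced {S : Type} (w : TimedWord S) (p : ℝ≥0) : Prop :=
  ∀ i : Fin w.len, w.time i = (i.val + 1) * p

namespace TimedWord

/-- The evenly spaced word with the first `len` letters of a sequence. -/
def ofSeq {S : Type} (p : ℝ≥0) (len : ℕ) (hlen : 0 < len) (u : ℕ → S) : TimedWord S where
  len := len
  len_pos := hlen
  letter i := u i
  time i := (i.val + 1) * p
  time_mono i j h := by
    have : (i.val : ℝ≥0) ≤ j.val := by exact_mod_cast h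
    dsimp only
    gcongr

theorem evenlySpaced_ofSeq {S : Type} (p : ℝ≥0) (len : ℕ) (hlen : 0 < len) (u : ℕ → S) :
    (ofSeq p len hlen u).EvenlySpaced p := fun _ => rfl

theorem EvenlySpaced.time_sub {S : Type} {w : TimedWord S} {p : ℝ≥0} (hw : w.EvenlySpaced p)
    (i j : Fin w.len) : (w.time j : ℝ) - w.time i = ((j.val : ℝ) - i.val) * p := by
  rw [hw, hw]
  push_cast
  ring

theorem EvenlySpaced.time_sub_inv {S : Type} {w : TimedWord S} {N : ℕ}
    (hw : w.EvenlySpaced (N : ℝ≥0)⁻¹) (i j : Fin w.len) :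
    (w.time j : ℝ) - w.time i = ((j.val : ℝ) - i.val) / N := by
  rw [hw.time_sub]
  push_cast
  rfl

end TimedWord

namespace MTL

variable {S : Type} [Inhabited S] {w : TimedWord S}

/-- Satisfied by some evenly spaced words with spacing `p`, unless `p` is `1 / N` for some `N`: two
letters coincide in time, or there is a position at distance at least one from the first
position, but none at distance exactly one. -/
def offGrid : MTL S :=
  disj (untl (.Icc 0 0) falsum verum)
    (conj (eventually (.Ici 1) verum) (neg (eventually (.Icc 1 1) verum)))

theorem exists_sat_offGrid {p : ℝ≥0} (hp : ∀ N : ℕ, (N : ℝ) * p ≠ 1) :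
    ∃ w : TimedWord S, w.EvenlySpaced p ∧ offGrid.Sat w := by
  -- A word long enough to cover one time unit, if that is possible at all.
  obtain ⟨m, hm⟩ : ∃ m : ℕ, p ≠ 0 → 1 ≤ (m : ℝ) * p := by
    by_cases h : p = 0
    · exact ⟨0, fun h' => (h' h).elim⟩
    · have : (0 : ℝ) < p := by exact_mod_cast pos_iff_ne_zero.2 h
      obtain ⟨m, hm⟩ := exists_nat_ge (1 / (p : ℝ))
      exact ⟨m, fun _ => by rwa [div_le_iff₀ this] at hm⟩
  have hw := TimedWord.evenlySpaced_ofSeq p (m + 2) (by omega) (fun _ => (default : S))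
  refine ⟨_, hw, ?_⟩
  rw [Sat, offGrid, satAt_disj, satAt_untl_falsum]
  by_cases h : p = 0
  · refine Or.inl ⟨by simp [TimedWord.ofSeq], satAt_verum, ?_⟩
    rw [hw.time_sub]
    simp [h, TimeInterval.toSet]
  · refine Or.inr ⟨?_, fun h₁ => ?_⟩
    · rw [satAt_eventually]
      refine ⟨⟨m + 1, by simp [TimedWord.ofSeq]⟩, Fin.lt_def.2 (by simp), satAt_verum, ?_⟩
      rw [hw.time_sub]
      have := hm h
      have : (0 : ℝ) ≤ p := p.2
      simp only [TimeInterval.toSet, Set.mem_Ici]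
      push_cast
      nlinarith
    · obtain ⟨j, -, -, hj⟩ := satAt_eventually.1 h₁
      rw [hw.time_sub] at hj
      refine hp j.val ?_
      simpa [TimeInterval.toSet, le_antisymm_iff, and_comm] using hj

section Grid

variable {N : ℕ} {i : Fin w.len}

theorem satAt_eventually_one (hN : 0 < N) (hw : w.EvenlySpaced (N : ℝ≥0)⁻¹) {φ : MTL S} :
    (eventually (.Icc 1 1) φ).SatAt w i ↔
      ∃ h : i.val + N < w.len, φ.SatAt w ⟨i + N, h⟩ := by
  have hN' : (0 : ℝ) < N := by exact_mod_cast hN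
  have key : ∀ j : Fin w.len, ((w.time j : ℝ) - w.time i) ∈ (TimeInterval.Icc 1 1).toSet ↔
      j.val = i + N := by
    intro j
    rw [hw.time_sub_inv]
    simp only [TimeInterval.toSet, Nat.cast_one, Set.Icc_self, Set.mem_singleton_iff]
    rw [div_eq_one_iff_eq hN'.ne', sub_eq_iff_eq_add']
    exact_mod_cast Iff.rfl
  rw [satAt_eventually]
  constructor
  · rintro ⟨⟨j, hj⟩, -, h₁, h₂⟩
    obtain rfl := (key _).1 h₂
    exact ⟨hj, h₁⟩
  · rintro ⟨h, h₁⟩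
    exact ⟨_, Fin.lt_def.2 (by simpa using hN), h₁, (key _).2 rfl⟩

theorem not_sat_offGrid (hN : 0 < N) (hw : w.EvenlySpaced (N : ℝ≥0)⁻¹) :
    ¬ (offGrid : MTL S).Sat w := by
  have hN' : (0 : ℝ) < N := by exact_mod_cast hN
  rw [Sat, offGrid, satAt_disj, satAt_untl_falsum]
  rintro (⟨h, -, h₁⟩ | ⟨h₁, h₂⟩)
  · rw [hw.time_sub_inv] at h₁
    simp [TimeInterval.toSet] at h₁
    omega
  · refine h₂ ((satAt_eventually_one hN hw).2 ?_)
    obtain ⟨j, -, -, hj⟩ := satAt_eventually.1 h₁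
    rw [hw.time_sub_inv] at hj
    simp only [TimeInterval.toSet, Set.mem_Ici, Nat.cast_one, Nat.cast_zero, sub_zero] at hj
    rw [le_div_iff₀ hN', one_mul] at hj
    have : N ≤ j.val := by exact_mod_cast hj
    exact ⟨by have := j.2; simp only; omega, satAt_verum⟩

theorem sat_neg_eventually_Ioo (hN : 0 < N) (hw : w.EvenlySpaced (N : ℝ≥0)⁻¹) {φ : MTL S} :
    (neg (eventually (.Ioo 0 1) φ)).Sat w ↔
      ∀ j : Fin w.len, 0 < j.val → j.val < N → ¬ φ.SatAt w j := by
  have hN' : (0 : ℝ) < N := by exact_mod_cast hN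
  rw [Sat, SatAt, satAt_eventually]
  push Not
  refine forall_congr' fun j => ?_
  rw [hw.time_sub_inv]
  simp only [TimeInterval.toSet, Set.mem_Ioo, Fin.lt_def, Nat.cast_zero, Nat.cast_one, sub_zero]
  rw [div_lt_one hN', Nat.cast_lt]
  have : 0 < j.val → (0 : ℝ) < (j.val : ℝ) / N := fun h => div_pos (by exact_mod_cast h) hN'
  tauto

theorem sat_neg_eventually_Ioc (hN : 0 < N) (hw : w.EvenlySpaced (N : ℝ≥0)⁻¹) {φ : MTL S} :
    (neg (eventually (.Ioc 0 1) φ)).Sat w ↔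
      ∀ j : Fin w.len, 0 < j.val → j.val ≤ N → ¬ φ.SatAt w j := by
  have hN' : (0 : ℝ) < N := by exact_mod_cast hN
  rw [Sat, SatAt, satAt_eventually]
  push Not
  refine forall_congr' fun j => ?_
  rw [hw.time_sub_inv]
  simp only [TimeInterval.toSet, Set.mem_Ioc, Fin.lt_def, Nat.cast_zero, Nat.cast_one, sub_zero]
  rw [div_le_one hN', Nat.cast_le]
  have : 0 < j.val → (0 : ℝ) < (j.val : ℝ) / N := fun h => div_pos (by exact_mod_cast h) hN'
  tauto

end Grid

end MTL

/-! ### The automaton -/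

/-- One location, one clock and one parameter: each letter is read when the clock equals the
parameter, and the clock is reset. -/
def gridPTA (n : ℕ) : PTA (Fin n) (Fin 1) (Fin 1) (Fin 1) where
  init := {0}
  edges := (List.finRange n).map fun a => ⟨0, a, [⟨0, .eq, .inr 0⟩], {0}, 0⟩
  final := {0}

theorem gridPTA_deterministic (n : ℕ) : (gridPTA n).Deterministic := by
  refine ⟨⟨0, rfl⟩, fun e₁ h₁ e₂ h₂ hne _ hl => ?_⟩
  simp only [gridPTA, List.mem_map] at h₁ h₂
  obtain ⟨a, -, rfl⟩ := h₁
  obtain ⟨b, -, rfl⟩ := h₂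
  obtain rfl : a = b := hl
  exact (hne rfl).elim

theorem gridPTA_step_iff {n : ℕ} {pv : ParamVal (Fin 1)} {s s' : Fin 1 × ClockVal (Fin 1)}
    {a : Fin n} {δ : ℝ≥0} :
    (gridPTA n).Step pv s a δ s' ↔ s.2 0 + δ = ((pv 0 : ℚ≥0) : ℝ≥0) ∧ s'.2 = 0 := by
  have h0 : ∀ x : Fin 1, x = 0 := fun x => Subsingleton.elim _ _
  simp only [PTA.Step, gridPTA, List.mem_map, List.mem_finRange, true_and]
  constructor
  · rintro ⟨_, ⟨b, rfl⟩, -, -, -, h₁, h₂⟩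
    refine ⟨h₁ _ (List.mem_singleton_self _), h₂.trans (funext fun x => ?_)⟩
    simp [h0 x]
  · rintro ⟨h₁, h₂⟩
    refine ⟨_, ⟨a, rfl⟩, Subsingleton.elim _ _, rfl, Subsingleton.elim _ _, ?_, ?_⟩
    · intro g hg
      obtain rfl := List.mem_singleton.1 hg
      exact h₁
    · rw [h₂]
      funext x
      simp [h0 x]

theorem mem_language_gridPTA_iff {n : ℕ} {pv : ParamVal (Fin 1)} {w : TimedWord (Fin n)} :
    w ∈ (gridPTA n).language pv ↔ w.EvenlySpaced ((pv 0 : ℚ≥0) : ℝ≥0) := by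
  have hsum : ∀ (p : ℝ≥0) (i : Fin w.len), ∑ _j ∈ Finset.Iic i, p = (i.val + 1) * p := by
    intro p i
    simp
  constructor
  · rintro ⟨r, ⟨-, h0, -⟩, -, ht⟩ i
    have hzero : ∀ j : Fin (w.len + 1), (r.state j).2 0 = 0 := fun j => by
      refine Fin.cases (h0 0) (fun j => ?_) j
      rw [(gridPTA_step_iff.1 (r.step j)).2]
      rfl
    rw [ht, ← hsum]
    refine Finset.sum_congr rfl fun j _ => ?_
    have := (gridPTA_step_iff.1 (r.step j)).1
    rwa [hzero, zero_add] at this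
  · intro hw
    refine ⟨⟨fun _ => (0, 0), w.letter, fun _ => ((pv 0 : ℚ≥0) : ℝ≥0), fun i =>
      gridPTA_step_iff.2 ⟨zero_add _, rfl⟩⟩, ⟨?_, fun _ => rfl, ?_⟩, rfl, fun i => ?_⟩
    · simp [gridPTA]
    · simp [gridPTA]
    · rw [hw, hsum]

/-! ### Tableaux as a formula -/

namespace MTL

variable {S Q K Γ : Type} [Inhabited S] [Fintype S]

/-- The contents of the tiles from the current position on are the entries of the list, followed by
a blank. The end of the row may cut this off. -/
noncomputable def firstRow (f : S → Tile Q K Γ) : List (K → Option Γ) → MTL S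
  | [] => letterIn fun a => (f a).content = fun _ => none
  | x :: l => conj (letterIn fun a => (f a).content = x)
      (next (disj (letterIn fun a => (f a).rowStart = true) (firstRow f l)))

/-- The current letters at the distances `0` and `1` in the word, together with those that come one
time unit later, violate the local condition on tableaux. -/
noncomputable def incompatible (M : StackMachine Q K Γ) (f : S → Tile Q K Γ) : MTL S :=
  open Classical in
  anyOf <| ((Finset.univ : Finset (S × S × S × S)).filter
    (fun x => ¬ M.Compatible (f x.1) (f x.2.1) (f x.2.2.1) (f x.2.2.2))).toList.map fun x =>
      conj (letter x.1) (conj (next (letter x.2.1))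
        (eventually (.Icc 1 1) (conj (letter x.2.2.1) (next (letter x.2.2.2)))))

/-- The conditions on a tableau that do not depend on the initial stacks. -/
noncomputable def tableauShape (M : StackMachine Q K Γ) (q₀ : Q) (f : S → Tile Q K Γ) : MTL S :=
  conj (letterIn fun a => (f a).state = q₀ ∧ (f a).rowStart = true) <|
  conj (neg (eventually (.Ioo 0 1) (letterIn fun a => (f a).rowStart = true))) <|
  conj (neg (eventually (.Ioc 0 1) (letterIn fun a => (f a).diagonal = true))) <|
  conj (neg (sometime (incompatible M f)))
    (sometime (conj (letterIn fun a => (f a).diagonal = true)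
      (next (conj (letterIn fun a => (f a).rowStart = true) (next verum)))))

/-- The word is not the tableau of a run from `q₀` whose initial stacks have the layers `l`, and
it does not witness that its spacing differs from all `1 / N`. -/
noncomputable def noTableau (M : StackMachine Q K Γ) (q₀ : Q) (f : S → Tile Q K Γ)
    (l : List (K → Option Γ)) : MTL S :=
  neg (disj offGrid (conj (tableauShape M q₀ f) (firstRow f l)))

variable {M : StackMachine Q K Γ} {q₀ : Q} {f : S → Tile Q K Γ} {w : TimedWord S}
  {u : ℕ → Tile Q K Γ}

theorem content_of_satAt_firstRow (hu : ∀ i : Fin w.len, f (w.letter i) = u i)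
    {l : List (K → Option Γ)} {i : Fin w.len} (h : (firstRow f l).SatAt w i) {j : ℕ}
    (hj : j ≤ l.length)
    (hrow : ∀ m, 0 < m → m ≤ j → i + m < w.len → (u (i + m)).rowStart = false) :
    (u (i + j)).content = l[j]?.getD fun _ => none := by
  induction l generalizing i j with
  | nil =>
    obtain rfl : j = 0 := by simpa using hj
    rw [firstRow, satAt_letterIn, hu] at h
    simpa using h
  | cons x l ih =>
    obtain ⟨h₁, h₂⟩ := h
    cases j with
    | zero =>
      rw [satAt_letterIn, hu] at h₁
      simpa using h₁
    | succ j =>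
      obtain ⟨hi, h₂⟩ := satAt_next.1 h₂
      rw [satAt_disj, satAt_letterIn, hu] at h₂
      obtain h₂ | h₂ := h₂
      · simp [hrow 1 one_pos (by omega) hi] at h₂
      · have := ih h₂ (j := j) (by simpa using hj) fun m hm hmj hmi => by
          have := hrow (m + 1) (by omega) (by omega) (by simp only at hmi; omega)
          rwa [add_comm m 1, ← add_assoc] at this
        simp only [add_assoc, add_comm 1 j] at this
        simpa using this

theorem satAt_firstRow (hu : ∀ i : Fin w.len, f (w.letter i) = u i) {N : ℕ} (hN : N < w.len)
    (hrow : (u N).rowStart = true) {l : List (K → Option Γ)} {i : Fin w.len} (hi : i.val < N)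
    (h : ∀ j ≤ l.length, i + j < N → (u (i + j)).content = l[j]?.getD fun _ => none) :
    (firstRow f l).SatAt w i := by
  induction l generalizing i with
  | nil =>
    rw [firstRow, satAt_letterIn, hu]
    simpa using h 0 le_rfl hi
  | cons x l ih =>
    refine ⟨?_, ?_⟩
    · rw [satAt_letterIn, hu]
      simpa using h 0 (Nat.zero_le _) hi
    · rw [satAt_next]
      refine ⟨by omega, ?_⟩
      rw [satAt_disj, satAt_letterIn, hu]
      obtain heq | hne := eq_or_ne (i.val + 1) N
      · exact Or.inl (by simpa only [heq] using hrow)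
      · refine Or.inr (ih (by simp only; omega) fun j hj hjN => ?_)
        have := h (j + 1) (by simpa using hj) (by simp only at hjN; omega)
        simpa [add_assoc, add_comm 1 j] using this

theorem sat_neg_sometime_incompatible (hu : ∀ i : Fin w.len, f (w.letter i) = u i) {N : ℕ}
    (hN : 0 < N) (hw : w.EvenlySpaced (N : ℝ≥0)⁻¹) :
    (neg (sometime (incompatible M f))).Sat w ↔
      ∀ i, i + N + 1 < w.len → M.Compatible (u i) (u (i + 1)) (u (i + N)) (u (i + N + 1)) := by
  change ¬ (sometime (incompatible M f)).Sat w ↔ _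
  have key : ∀ i : Fin w.len, (incompatible M f).SatAt w i ↔ ∃ _ : i + N + 1 < w.len,
      ¬ M.Compatible (u i) (u (i + 1)) (u (i + N)) (u (i + N + 1)) := by
    intro i
    simp only [incompatible, satAt_anyOf, List.mem_map, Finset.mem_toList, Finset.mem_filter,
      Finset.mem_univ, true_and]
    constructor
    · rintro ⟨_, ⟨⟨a, b, c, d⟩, hx, rfl⟩, h₁, h₂, h₃⟩
      obtain ⟨hi₁, rfl⟩ := satAt_next.1 h₂
      obtain ⟨hi₂, rfl, h₄⟩ := (satAt_eventually_one hN hw).1 h₃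
      obtain ⟨hi₃, rfl⟩ := satAt_next.1 h₄
      obtain rfl : w.letter i = a := h₁
      simp only [hu] at hx
      exact ⟨hi₃, hx⟩
    · rintro ⟨hi, hx⟩
      refine ⟨_, ⟨(w.letter i, w.letter ⟨i + 1, by omega⟩, w.letter ⟨i + N, by omega⟩,
        w.letter ⟨i + N + 1, hi⟩), ?_, rfl⟩, rfl, satAt_next.2 ⟨_, rfl⟩,
        (satAt_eventually_one hN hw).2 ⟨_, rfl, satAt_next.2 ⟨_, rfl⟩⟩⟩
      simpa only [hu] using hx
  rw [sat_sometime]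
  simp only [key]
  push Not
  exact ⟨fun h i hi => h ⟨i, by omega⟩ hi, fun h i hi => h i hi⟩

/-- On the grid of width `N`, the formula expresses exactly the notion of a tableau. Here `l` lists
the layers of the initial stacks `T`. -/
theorem sat_tableau_iff (hu : ∀ i : Fin w.len, f (w.letter i) = u i) {N : ℕ}
    (hN : 0 < N) (hw : w.EvenlySpaced (N : ℝ≥0)⁻¹) {l : List (K → Option Γ)} {T : K → List Γ}
    (hT : ∀ j, layer T j = l[j]?.getD fun _ => none) :
    (conj (tableauShape M q₀ f) (firstRow f l)).Sat w ↔
      M.IsTableau q₀ T l.length N w.len u := by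
  have h₀ : (u 0) = f (w.letter ⟨0, w.len_pos⟩) := (hu ⟨0, w.len_pos⟩).symm
  have hstart := sat_neg_eventually_Ioo hN hw (φ := letterIn fun a => (f a).rowStart = true)
  have hdiag := sat_neg_eventually_Ioc hN hw (φ := letterIn fun a => (f a).diagonal = true)
  simp only [satAt_letterIn, hu, Bool.not_eq_true] at hstart hdiag
  have hcomp := sat_neg_sometime_incompatible (M := M) hu hN hw
  have hlong : (sometime (conj (letterIn fun a => (f a).diagonal = true)
      (next (conj (letterIn fun a => (f a).rowStart = true) (next verum))))).Sat w ↔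
      ∃ i, i + 2 < w.len ∧ (u i).diagonal = true ∧ (u (i + 1)).rowStart = true := by
    rw [sat_sometime]
    constructor
    · rintro ⟨i, h₁, h₂⟩
      obtain ⟨hi, h₂, h₃⟩ := satAt_next.1 h₂
      rw [satAt_letterIn, hu] at h₁ h₂
      obtain ⟨hi', -⟩ := satAt_next.1 h₃
      exact ⟨i, hi', h₁, h₂⟩
    · rintro ⟨i, hi, h₁, h₂⟩
      refine ⟨⟨i, by omega⟩, ?_, satAt_next.2 ⟨by simp only; omega, ?_, ?_⟩⟩
      · rwa [satAt_letterIn, hu]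
      · rwa [satAt_letterIn, hu]
      · exact satAt_next.2 ⟨hi, satAt_verum⟩
  constructor
  · rintro ⟨⟨h₁, h₂, h₃, h₄, h₅⟩, h₆⟩
    rw [satAt_letterIn, ← h₀] at h₁
    refine ⟨h₁.1, h₁.2, fun j hj hjl => ?_, fun j hj hjN hjw => hstart.1 h₂ ⟨j, hjw⟩ hj hjN,
      fun j hj hjN hjw => hdiag.1 h₃ ⟨j, hjw⟩ hj hjN, hcomp.1 h₄, hlong.1 h₅⟩
    have := content_of_satAt_firstRow hu h₆ hjl fun m hm hmj hmw => by
      simp only [zero_add] at hmw ⊢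
      exact hstart.1 h₂ ⟨m, hmw⟩ hm (by simp only; omega)
    rw [hT]
    simpa using this
  · intro h
    have hlen := h.sq_lt_len hN
    have hlen' : N + 1 < w.len := by
      obtain ⟨i, hi, -, hs⟩ := h.long
      have hd := (h.rowStart_iff hN (i + 1) (by omega)).1 hs
      have := Nat.le_of_dvd (by omega) hd
      omega
    refine ⟨⟨?_, hstart.2 fun j hj hjN => h.not_rowStart j hj hjN j.2,
      hdiag.2 fun j hj hjN => h.not_diagonal j hj hjN j.2, hcomp.2 h.compatible,
      hlong.2 h.long⟩, ?_⟩
    · rw [satAt_letterIn, ← h₀]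
      exact ⟨h.first_state, h.first_rowStart⟩
    · refine satAt_firstRow hu (N := N) (by omega) ?_ hN fun j hj hjN => ?_
      · exact (h.rowStart_iff hN N hlen').2 dvd_rfl
      · simp only [zero_add] at hjN ⊢
        rw [h.first_row j hjN hj, hT]

end MTL

open MTL in
/-- The reduction: the model checking problem asks for a space bound within which the machine
halts. -/
theorem exists_paramVal_iff_halts {n : ℕ} [Inhabited (Fin n)] {Q K Γ : Type}
    (M : StackMachine Q K Γ) (q₀ : Q) (e : Fin n ≃ Tile Q K Γ) {l : List (K → Option Γ)}
    {T : K → List Γ} (hT : ∀ j, layer T j = l[j]?.getD fun _ => none) :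
    (∃ pv : ParamVal (Fin 1), ∀ w ∈ (gridPTA n).language pv, (noTableau M q₀ e l).Sat w) ↔
      M.Halts (q₀, T) := by
  simp only [mem_language_gridPTA_iff]
  constructor
  · rintro ⟨pv, h⟩
    by_contra hM
    -- For every parameter value some word violates the formula.
    generalize ((pv 0 : ℚ≥0) : ℝ≥0) = p at h
    by_cases hp : ∃ N : ℕ, (N : ℝ) * p = 1
    · obtain ⟨N, hNp⟩ := hp
      have hN : 0 < N := Nat.pos_of_ne_zero fun h0 => by simp [h0] at hNp
      obtain rfl : p = (N : ℝ≥0)⁻¹ := by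
        exact eq_inv_of_mul_eq_one_right (by exact_mod_cast hNp)
      have hw := TimedWord.evenlySpaced_ofSeq (N : ℝ≥0)⁻¹ (N * N + 2) (by omega)
        fun i => e.symm (M.tableau (q₀, T) N i)
      refine h _ hw (satAt_disj.2 (Or.inr ?_))
      exact (sat_tableau_iff (u := M.tableau (q₀, T) N) (fun i => e.apply_symm_apply _) hN hw hT).2
        (StackMachine.isTableau_tableau hM _ hN (Nat.lt_succ_self _))
    · push Not at hp
      obtain ⟨w, hw, hoff⟩ := exists_sat_offGrid (S := Fin n) hp
      exact h w hw (satAt_disj.2 (Or.inl hoff))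
  · intro hM
    have hlen : ∀ k, (T k).length ≤ l.length := fun k => by
      have := congrFun (hT l.length) k
      rw [List.getElem?_eq_none le_rfl] at this
      exact List.getElem?_eq_none_iff.1 this
    obtain ⟨N, hN, hno⟩ := StackMachine.exists_forall_not_isTableau hlen hM
    refine ⟨fun _ => (N : ℚ≥0)⁻¹, fun w hw h => ?_⟩
    push_cast at hw
    obtain h | h := satAt_disj.1 h
    · exact not_sat_offGrid hN hw h
    · refine hno w.len (fun i => if hi : i < w.len then e (w.letter ⟨i, hi⟩) else e default) ?_
      exact (sat_tableau_iff (fun i => by simp) hN hw hT).1 h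

/-! ### Computability of the reduction -/

/-- Functions defined by recursion on the binary representation are primitive recursive. -/
theorem Primrec.of_binary_rec {g h₀ h₁ : ℕ → ℕ} (hh₀ : Primrec h₀) (hh₁ : Primrec h₁)
    (hg : ∀ n, 0 < n → g n = if n % 2 = 1 then h₁ (g (n / 2)) else h₀ (g (n / 2))) :
    Primrec g := by
  -- Course-of-values recursion: `l` lists the values of `g` at all smaller arguments.
  let step : Unit → List ℕ → Option ℕ := fun _ l =>
    if l.length = 0 then some (g 0) else
      (l[l.length / 2]?).map fun x => if l.length % 2 = 1 then h₁ x else h₀ x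
  have hlen : Primrec fun x : Unit × List ℕ => x.2.length := Primrec.list_length.comp Primrec.snd
  have hstep : Primrec₂ step := by
    refine Primrec.ite (Primrec.eq.comp hlen (Primrec.const 0)) (Primrec.const _) ?_
    refine Primrec.option_map (Primrec.list_getElem?.comp Primrec.snd
      (Primrec.nat_div.comp hlen (Primrec.const 2))) ?_
    exact Primrec.ite (Primrec.eq.comp (Primrec.nat_mod.comp (hlen.comp Primrec.fst)
      (Primrec.const 2)) (Primrec.const 1)) (hh₁.comp Primrec.snd) (hh₀.comp Primrec.snd)
  refine (Primrec.nat_strong_rec (fun _ : Unit => g) hstep fun _ n => ?_).comp (Primrec.const ())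
    Primrec.id
  obtain rfl | hn := Nat.eq_zero_or_pos n
  · simp [step]
  · have : n / 2 < n := Nat.div_lt_self hn one_lt_two
    simp [step, hn.ne', this, hg n hn]

namespace Turing.PartrecToTM2

/-- Binary representations are written with the least significant digit first. -/
theorem trNat_of_pos {n : ℕ} (hn : 0 < n) :
    trNat n = (if n % 2 = 1 then Γ'.bit1 else Γ'.bit0) :: trNat (n / 2) := by
  have h₁ : ∀ x : Num, trNum x.bit1 = Γ'.bit1 :: trNum x := fun x => by cases x <;> rfl
  have h₀ : ∀ x : Num, x ≠ 0 → trNum x.bit0 = Γ'.bit0 :: trNum x := fun x hx => by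
    cases x with
    | zero => exact (hx rfl).elim
    | pos x => rfl
  obtain ⟨m, rfl | rfl⟩ := Nat.even_or_odd' n
  · have hm : (m : Num) ≠ 0 := by
      intro h
      have : m = 0 := by exact_mod_cast h
      omega
    have e : ((2 * m : ℕ) : Num) = (m : Num).bit0 := by
      rw [← Num.bit0_of_bit0]
      push_cast
      ring
    rw [trNat, e, h₀ _ hm]
    simp [trNat]
  · have e : ((2 * m + 1 : ℕ) : Num) = (m : Num).bit1 := by
      rw [← Num.bit1_of_bit1]
      push_cast
      ring
    rw [trNat, e, h₁]
    simp [trNat, Nat.mul_add_div, Nat.add_mod]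

end Turing.PartrecToTM2

namespace MTL

section Code

variable {n : ℕ} {F : MTL (Fin n) → MTL (Fin n)}

/-- The Gödel number of `F φ` is a primitive recursive function of the Gödel number of `φ`. -/
def PrimrecCode (F : MTL (Fin n) → MTL (Fin n)) : Prop :=
  ∃ h : ℕ → ℕ, Primrec h ∧ ∀ φ, (F φ).code = h φ.code

theorem PrimrecCode.id : PrimrecCode fun φ : MTL (Fin n) => φ :=
  ⟨_, Primrec.id, fun _ => rfl⟩

theorem PrimrecCode.neg (hF : PrimrecCode F) : PrimrecCode fun φ => neg (F φ) := by
  obtain ⟨h, hh, e⟩ := hF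
  refine ⟨fun c => Nat.pair 1 (h c), Primrec₂.natPair.comp (Primrec.const 1) hh, fun φ => ?_⟩
  rw [code, e]

theorem PrimrecCode.conj (ψ : MTL (Fin n)) (hF : PrimrecCode F) :
    PrimrecCode fun φ => conj ψ (F φ) := by
  obtain ⟨h, hh, e⟩ := hF
  refine ⟨fun c => Nat.pair 2 (Nat.pair ψ.code (h c)), Primrec₂.natPair.comp (Primrec.const 2)
    (Primrec₂.natPair.comp (Primrec.const _) hh), fun φ => ?_⟩
  rw [code, e]

theorem PrimrecCode.untl (I : TimeInterval) (ψ : MTL (Fin n)) (hF : PrimrecCode F) :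
    PrimrecCode fun φ => untl I ψ (F φ) := by
  obtain ⟨h, hh, e⟩ := hF
  refine ⟨fun c => Nat.pair 3 (Nat.pair I.code (Nat.pair ψ.code (h c))),
    Primrec₂.natPair.comp (Primrec.const 3) (Primrec₂.natPair.comp (Primrec.const _)
      (Primrec₂.natPair.comp (Primrec.const _) hh)), fun φ => ?_⟩
  rw [code, e]

theorem PrimrecCode.disj (ψ : MTL (Fin n)) (hF : PrimrecCode F) :
    PrimrecCode fun φ => disj ψ (F φ) :=
  (hF.neg.conj _).neg

end Code

end MTL

section

open Turing Turing.PartrecToTM2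

instance : Finite K' :=
  Finite.of_injective (β := Fin 4) (fun k => K'.rec 0 1 2 3 k) fun a b => by
    cases a <;> cases b <;> simp

/-- The layer with entry `x` on the main stack and no entry on the other stacks. -/
def mainLayer (x : Γ') : K' → Option Γ'
  | .main => some x
  | _ => none

/-- The layers of the initial stacks of the machine on input `n`. -/
def inputLayers (n : ℕ) : List (K' → Option Γ') :=
  (trList [n]).map mainLayer

/-- The empty layer below the bottom of the stacks is not listed. -/
theorem layer_input (n j : ℕ) :
    layer (K'.elim (trList [n]) [] [] []) j = (inputLayers n)[j]?.getD fun _ => none := by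
  funext k
  simp only [inputLayers, layer, List.getElem?_map]
  cases k <;> simp only [K'.elim] <;> cases (trList [n])[j]? <;> rfl

/-- The layers for input `m` are those for input `m / 2`, preceded by the layer of the last binary
digit of `m`. -/
theorem primrec_code_firstRow_inputLayers {n : ℕ} [Inhabited (Fin n)] {Q : Type}
    (f : Fin n → Tile Q K' Γ') : Primrec fun m => (MTL.firstRow f (inputLayers m)).code := by
  obtain ⟨h₀, hh₀, e₀⟩ :=
    ((MTL.PrimrecCode.id.disj (MTL.letterIn fun a => (f a).rowStart = true)).untl (.Ici 0)
      MTL.falsum).conj (MTL.letterIn fun a => (f a).content = mainLayer Γ'.bit0)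
  obtain ⟨h₁, hh₁, e₁⟩ :=
    ((MTL.PrimrecCode.id.disj (MTL.letterIn fun a => (f a).rowStart = true)).untl (.Ici 0)
      MTL.falsum).conj (MTL.letterIn fun a => (f a).content = mainLayer Γ'.bit1)
  refine Primrec.of_binary_rec hh₀ hh₁ fun m hm => ?_
  have : inputLayers m = mainLayer (if m % 2 = 1 then Γ'.bit1 else Γ'.bit0) ::
      inputLayers (m / 2) := by
    simp [inputLayers, trNat_of_pos hm]
  rw [this]
  split_ifs
  · exact e₁ _
  · exact e₀ _

theorem not_mcDecidableOn_one_clock_one_param :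
    ¬ MCDecidableOn {I | I.aut.Deterministic ∧ I.numClocks = 1 ∧ I.numParams = 1} := by
  rintro ⟨F, hF, hcorrect⟩
  obtain ⟨Q, _, M, q₀, hM⟩ := exists_stackMachine_not_computablePred
  obtain ⟨n, ⟨e⟩⟩ := Finite.exists_equiv_fin (Tile Q K' Γ')
  let _ : Inhabited (Fin n) := ⟨e ⟨q₀, fun _ => none, true, true⟩⟩
  let I : ℕ → MCInput := fun m =>
    ⟨n, 1, 1, 1, gridPTA n, MTL.noTableau M q₀ e.symm (inputLayers m)⟩
  have hI : ∀ m, (I m).Holds ↔ M.Halts (q₀, K'.elim (trList [m]) [] [] []) := fun m =>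
    exists_paramVal_iff_halts M q₀ e.symm (layer_input m)
  have hcode : Computable fun m => (I m).code := by
    obtain ⟨h, hh, eh⟩ := ((MTL.PrimrecCode.id.conj (MTL.tableauShape M q₀ e.symm)).disj
      MTL.offGrid).neg
    have hspec : Primrec fun m => (MTL.noTableau M q₀ e.symm (inputLayers m)).code :=
      (hh.comp (primrec_code_firstRow_inputLayers _)).of_eq fun m => (eh _).symm
    exact ((Primrec.const ((n, 1, 1, 1) : ℕ × ℕ × ℕ × ℕ)).pair
      ((Primrec.const ((bitVector (gridPTA n).init, (gridPTA n).edges.map PTAEdge.code,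
        bitVector (gridPTA n).final) : List Bool × List EdgeCode × List Bool)).pair hspec)).to_comp
  classical
  refine hM ⟨inferInstance, (hF.comp hcode).of_eq fun m => ?_⟩
  obtain ⟨b, hb, hb'⟩ := hcorrect (I m) ⟨gridPTA_deterministic n, rfl, rfl⟩
  refine (Part.eq_some_iff.2 hb).trans (congrArg Part.some ?_)
  rw [Bool.eq_iff_iff, hb', hI, decide_eq_true_iff]

end

theorem theorem1 :
    ¬ MCDecidableOn Set.univ ∧
    ¬ MCDecidableOn {I | I.aut.Deterministic ∧ I.numClocks = 1 ∧ I.numParams = 1} := by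
  refine ⟨fun ⟨F, hF, hcorrect⟩ => ?_, not_mcDecidableOn_one_clock_one_param⟩
  exact not_mcDecidableOn_one_clock_one_param ⟨F, hF, fun I _ => hcorrect I trivial⟩
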